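/- For non-negative integers $n,k$ let $d(n,k)$ be the number of derangements of length $n$ (permutations of $\{1,\dots,n\}$ without fixed points) that have exactly $k$ cycles, and let $D_n(x)=\sum_{k=1}^{\lfloor n/2\rfloor} d(n,k)\,x^k$. For every positive integer $t$ and every $\varepsilon>0$ there exists a positive integer $N$ such that for every integer $n>N$ the polynomial $D_n(x)$ has a real root $x_t$ satisfying $|-t-x_t|<\varepsilon$. Moreover, $N$ can be chosen so that, for all $n>N$ simultaneously, $0$ is a root of $D_n(x)$ and, for each integer $s$ with $1\le s\le t$, $D_n(x)$ has a real root $x_s$ satisfying $|-s-x_s|<\varepsilon$. -/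

import Mathlib

open Polynomial

/-- The number of cycles of a permutation of `{1, …, n}`, fixed points counted as cycles of
length one. -/
def numCycles {n : ℕ} (σ : Equiv.Perm (Fin n)) : ℕ :=
  σ.partition.parts.card

/-- `derangementCycleCount n k` is `d(n,k)`, the number of derangements of length `n` (permutations
of an `n`-element set without fixed points) that have exactly `k` cycles. -/
def derangementCycleCount (n k : ℕ) : ℕ :=
  (Finset.univ.filter fun σ : Equiv.Perm (Fin n) =>
    σ ∈ derangements (Fin n) ∧ numCycles σ = k).card

/-- `D_n(x) = ∑_{k=1}^{⌊n/2⌋} d(n,k) x^k`. -/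
noncomputable def derangementPoly (n : ℕ) : ℝ[X] :=
  ∑ k ∈ Finset.Icc 1 (n / 2), C (derangementCycleCount n k : ℝ) * X ^ k

/-!
The exponential generating function of the derangement cycle polynomials is
`(1 - z)⁻ˣ e^{-xz}`, so `D_n(x) / n!` is the convolution of the sequences `(x)ₙ / n!` and
`(-x)ʲ / j!`, where `(x)ₙ` is the rising factorial. It is derived here without power series: the
permutations of `n` points have cycle polynomial `(x)ₙ` (`sum_pow_cycleCount`), and
inclusion–exclusion over the set of fixed points gives
`D_n(x) = ∑ j, n.choose j * (-x)ʲ * (x)_{n-j}` (`eval_derangementPoly`).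

If `x` is not a non-positive integer, the ratio `(x)_{n-j} / (n-j)! : (x)ₙ / n!` tends to `1` for
each `j` and is at most `Kʲ` uniformly in `n`. Dominated convergence for series then gives
`D_n(x) / (x)ₙ → e⁻ˣ` (`tendsto_derangementPoly_ratio`), so for large `n` the value `D_n(x)` has the
sign of `(x)ₙ`. For `0 < δ < 1` the signs of `(-s - δ)ₙ` and `(-s + δ)ₙ` differ once `n > s`, because
only the factor `x + s` changes sign (`ascPochhammer_mul_neg`), and the intermediate value theorem
puts a root of `D_n` within `δ` of `-s`.
-/

/-! ### Counting permutations by number of cycles -/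

section CycleCount

open Equiv Equiv.Perm

variable {α β : Type*} [Fintype α] [DecidableEq α] [Fintype β] [DecidableEq β]

/-- The number of cycles of a permutation of a finite type, fixed points counted as cycles of
length one. -/
def cycleCount (σ : Perm α) : ℕ :=
  σ.partition.parts.card

theorem cycleCount_eq (σ : Perm α) :
    cycleCount σ = σ.cycleType.card + (Fintype.card α - σ.support.card) := by
  simp [cycleCount, parts_partition]

theorem cycleCount_extendDomain {p : β → Prop} [DecidablePred p] (f : α ≃ Subtype p)
    (σ : Perm α) :
    cycleCount (σ.extendDomain f) = cycleCount σ + (Fintype.card β - Fintype.card α) := by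
  have h1 : σ.support.card ≤ Fintype.card α := Finset.card_le_univ _
  have h2 : Fintype.card α ≤ Fintype.card β :=
    (Fintype.card_congr f).trans_le (Fintype.card_subtype_le p)
  rw [cycleCount_eq, cycleCount_eq, cycleType_extendDomain, card_support_extend_domain]
  omega

theorem cycleCount_permCongr (e : α ≃ β) (σ : Perm α) :
    cycleCount (e.permCongr σ) = cycleCount σ := by
  have h : e.permCongr σ =
      σ.extendDomain (e.trans (Equiv.subtypeUnivEquiv (p := fun _ => True) (by simp)).symm) := by
    ext b
    rw [extendDomain_apply_subtype _ _ trivial]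
    rfl
  rw [h, cycleCount_extendDomain, Fintype.card_congr e]
  omega

theorem cycleCount_optionCongr (σ : Perm α) :
    cycleCount σ.optionCongr = cycleCount σ + 1 := by
  have h : σ.optionCongr = σ.extendDomain (Equiv.optionIsSomeEquiv α).symm := by
    ext1 b
    cases b with
    | none => rw [extendDomain_apply_not_subtype _ _ (by simp)]; rfl
    | some a => rw [extendDomain_apply_subtype _ _ (by simp)]; rfl
  rw [h, cycleCount_extendDomain, Fintype.card_option]
  omega

/-- Multiplying by a transposition that involves a fixed point `p` of `σ` inserts `p` into the
cycle of `q`, so the cycle `(p)` is lost. -/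
theorem cycleCount_swap_mul {σ : Perm α} {p q : α} (hp : σ p = p) (hpq : p ≠ q) :
    cycleCount (swap p q * σ) + 1 = cycleCount σ := by
  by_cases hq : σ q = q
  · have hd : (swap p q).Disjoint σ := by
      rw [disjoint_iff_disjoint_support, support_swap hpq]
      simp [Finset.disjoint_left, hp, hq]
    have hcard : (swap p q * σ).support.card ≤ Fintype.card α := Finset.card_le_univ _
    rw [hd.card_support_mul, card_support_swap hpq] at hcard
    rw [cycleCount_eq, cycleCount_eq, hd.cycleType_mul, hd.card_support_mul,
      card_support_swap hpq, (isCycle_swap hpq).cycleType, Multiset.card_add,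
      Multiset.card_singleton]
    omega
  -- Split off the cycle `c` of `q`; then `swap p q * c` is again a cycle, on one more point.
  · set c := σ.cycleOf q with hc
    have hqs : q ∈ σ.support := by simpa using hq
    have hcycle : c.IsCycle := isCycle_cycleOf σ hq
    have hd : (σ * c⁻¹).Disjoint c :=
      disjoint_mul_inv_of_mem_cycleFactorsFinset (cycleOf_mem_cycleFactorsFinset_iff.2 hqs)
    set r := σ * c⁻¹ with hr
    have hσ : σ = c * r := by rw [← hd.commute.eq, hr, inv_mul_cancel_right]
    have hl : σ.toList q = q :: (σ.toList q).tail := by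
      have hpos := length_toList_pos_of_mem_support _ _ hqs
      have h0 := toList_getElem_zero _ _ hqs
      cases hL : σ.toList q with
      | nil => simp [hL] at hpos
      | cons a l => simpa [hL] using h0
    have hc' : swap p q * c = List.formPerm (p :: σ.toList q) := by
      rw [hc, ← formPerm_toList, hl, List.formPerm_cons_cons]
    -- `p` is not on the cycle of `q`, because `σ` fixes `p` and moves `q`.
    have hpl : p ∉ σ.toList q := fun h => by
      have := (mem_toList_iff.1 h)
      exact (this.1.apply_eq_self_iff.not.1 hq) hp
    have hnd : (p :: σ.toList q).Nodup := List.nodup_cons.2 ⟨hpl, nodup_toList _ _⟩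
    have hlen := two_le_length_toList_iff_mem_support.2 hqs
    have hcycle' : (swap p q * c).IsCycle := by
      rw [hc']
      exact List.isCycle_formPerm hnd (by simp; omega)
    have hsupp' : (swap p q * c).support = insert p c.support := by
      rw [hc', List.support_formPerm_of_nodup _ hnd (by
        intro x hx
        have := congrArg List.length hx
        simp at this
        simp [this] at hlen), List.toFinset_cons, hc, ← formPerm_toList,
        List.support_formPerm_of_nodup _ (nodup_toList _ _) (toList_ne_singleton _ _)]
    have hpc : p ∉ c.support := fun h => by
      have := support_cycleOf_le σ q h
      simp [hp] at this
    have hpr : p ∉ r.support := fun h => by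
      have hpc' : c p = p := by simpa using hpc
      have h1 : r p = p := by
        rw [hr, mul_apply, Equiv.Perm.inv_eq_iff_eq.2 hpc'.symm, hp]
      simp [h1] at h
    have hd' : (swap p q * c).Disjoint r := by
      rw [disjoint_iff_disjoint_support, hsupp', Finset.disjoint_insert_left]
      exact ⟨hpr, hd.symm.disjoint_support⟩
    have hcard : (swap p q * c * r).support.card ≤ Fintype.card α := Finset.card_le_univ _
    rw [hd'.card_support_mul, hsupp', Finset.card_insert_of_notMem hpc] at hcard
    have h1 : cycleCount (swap p q * σ) = cycleCount (swap p q * c * r) := by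
      rw [mul_assoc, ← hσ]
    rw [h1, hσ, cycleCount_eq, cycleCount_eq, hd'.cycleType_mul, hd'.card_support_mul,
      hd.symm.cycleType_mul, hd.symm.card_support_mul, hcycle.cycleType, hcycle'.cycleType, hsupp',
      Finset.card_insert_of_notMem hpc]
    simp only [Multiset.card_add, Multiset.card_singleton]
    omega

/-- The generating polynomial of the permutations of `n` points by number of cycles is the rising
factorial: when a point is added, it either forms a cycle of its own (factor `x`) or is inserted in
front of one of the `n` old points. -/
theorem sum_pow_cycleCount (x : ℝ) (α : Type) [Fintype α] [DecidableEq α] :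
    ∑ σ : Perm α, x ^ cycleCount σ = (ascPochhammer ℝ (Fintype.card α)).eval x := by
  refine Fintype.induction_empty_option (P := fun α _ => ∀ [DecidableEq α],
    ∑ σ : Perm α, x ^ cycleCount σ = (ascPochhammer ℝ (Fintype.card α)).eval x) ?_ ?_ ?_ α
  · intro α β _ e ih _
    let _ := Fintype.ofEquiv β e.symm
    let _ := e.injective.decidableEq
    rw [← Fintype.card_congr e]
    convert ih using 1
    rw [← e.permCongr.sum_comp]
    simp [cycleCount_permCongr]
  · intro _
    simp [cycleCount_eq]
  · intro α _ ih hdec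
    classical
    obtain rfl : hdec = Option.instDecidableEq := Subsingleton.elim _ _
    rw [← decomposeOption.symm.sum_comp, Fintype.sum_prod_type, Fintype.sum_option]
    have h (a : α) (σ : Perm α) :
        cycleCount (decomposeOption.symm (some a, σ)) = cycleCount σ := by
      have := cycleCount_swap_mul (σ := σ.optionCongr) (p := none) (q := some a) (by simp) (by simp)
      rw [cycleCount_optionCongr] at this
      exact Nat.succ_injective this
    have h0 (σ : Perm α) : cycleCount (decomposeOption.symm (none, σ)) = cycleCount σ + 1 := by
      rw [← cycleCount_optionCongr, decomposeOption_symm_apply, swap_self, ← Perm.one_def, one_mul]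
    simp only [h, h0, pow_succ, ← Finset.sum_mul, ih, Finset.sum_const, Finset.card_univ,
      Fintype.card_option, ascPochhammer_succ_eval, nsmul_eq_mul]
    ring

/-- The permutations fixing `S` pointwise are the permutations of the complement, with `|S|`
additional cycles. -/
theorem sum_pow_cycleCount_of_fixing (x : ℝ) {n : ℕ} (S : Finset (Fin n)) :
    ∑ σ : Perm (Fin n) with ∀ i ∈ S, σ i = i, x ^ cycleCount σ =
      x ^ S.card * (ascPochhammer ℝ (n - S.card)).eval x := by
  have hcard : Fintype.card {i // i ∉ S} = n - S.card := by
    simp [Fintype.card_subtype_compl]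
  have hS : S.card ≤ n := by simpa using S.card_le_univ
  have hof (τ : Perm {i // i ∉ S}) : cycleCount (ofSubtype τ) = cycleCount τ + S.card := by
    have h1 : τ.support.card ≤ Fintype.card {i // i ∉ S} := Finset.card_le_univ _
    rw [cycleCount_eq, cycleCount_eq, cycleType_ofSubtype, support_ofSubtype, Finset.card_map,
      hcard, Fintype.card_fin]
    omega
  rw [Finset.sum_subtype (p := fun σ : Perm (Fin n) => ∀ i, ¬ i ∉ S → σ i = i) _ (by simp),
    ← (Perm.subtypeEquivSubtypePerm (· ∉ S)).sum_comp, ← hcard, ← sum_pow_cycleCount,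
    Finset.mul_sum]
  refine Finset.sum_congr rfl fun τ _ => ?_
  rw [Perm.subtypeEquivSubtypePerm_apply_coe, hof, pow_add, mul_comm]

/-! ### The cycle polynomial of derangements -/

/-- Inclusion–exclusion over the set of fixed points. -/
theorem sum_derangements_pow_cycleCount (x : ℝ) (n : ℕ) :
    ∑ σ : Perm (Fin n) with σ ∈ derangements (Fin n), x ^ cycleCount σ =
      ∑ j ∈ Finset.range (n + 1),
        (n.choose j : ℝ) * ((-x) ^ j * (ascPochhammer ℝ (n - j)).eval x) := by
  have hind (σ : Perm (Fin n)) : (if σ ∈ derangements (Fin n) then x ^ cycleCount σ else 0) =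
      ∑ S : Finset (Fin n),
        if ∀ i ∈ S, σ i = i then (-1 : ℝ) ^ S.card * x ^ cycleCount σ else 0 := by
    have h1 : (if σ ∈ derangements (Fin n) then (1 : ℝ) else 0) =
        ∏ i : Fin n, (1 + -(if σ i = i then (1 : ℝ) else 0)) := by
      split_ifs with h
      · rw [Finset.prod_congr rfl fun i _ => by rw [if_neg (h i)]]
        simp
      · obtain ⟨i, hi⟩ : ∃ i, σ i = i := by simpa [derangements] using h
        exact (Finset.prod_eq_zero (Finset.mem_univ i) (by simp [hi])).symm
    rw [Finset.prod_one_add, Finset.powerset_univ] at h1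
    rw [← mul_one (x ^ _), ← mul_ite_zero, h1, Finset.mul_sum]
    refine Finset.sum_congr rfl fun S _ => ?_
    rw [Finset.prod_neg, Finset.prod_ite_zero]
    split_ifs <;> simp [mul_comm]
  rw [Finset.sum_filter, Finset.sum_congr rfl fun σ _ => hind σ, Finset.sum_comm]
  have h2 (S : Finset (Fin n)) :
      (∑ σ : Perm (Fin n), if ∀ i ∈ S, σ i = i then (-1 : ℝ) ^ S.card * x ^ cycleCount σ else 0) =
        (-x) ^ S.card * (ascPochhammer ℝ (n - S.card)).eval x := by
    rw [← Finset.sum_filter, ← Finset.mul_sum, sum_pow_cycleCount_of_fixing, neg_pow x, mul_assoc]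
  rw [Finset.sum_congr rfl fun S _ => h2 S, ← Finset.powerset_univ,
    Finset.sum_powerset_apply_card fun m => (-x) ^ m * (ascPochhammer ℝ (n - m)).eval x]
  simp

/-- All cycles of a derangement have length at least two, so the range of summation in
`derangementPoly` misses none of the derangements. -/
theorem cycleCount_mem_Icc {n : ℕ} (hn : 0 < n) {σ : Perm (Fin n)}
    (hσ : σ ∈ derangements (Fin n)) : cycleCount σ ∈ Finset.Icc 1 (n / 2) := by
  have hs : σ.support = Finset.univ := by
    ext i
    simpa using hσ i
  have hcard : σ.support.card = n := by simp [hs]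
  have hne : σ ≠ 1 := by
    rintro rfl
    simp at hcard
    omega
  have h1 := card_cycleType_pos.2 hne
  have h2 : σ.cycleType.card * 2 ≤ σ.cycleType.sum := by
    simpa using Multiset.card_nsmul_le_sum fun k hk => two_le_of_mem_cycleType hk
  rw [sum_cycleType, hcard] at h2
  rw [cycleCount_eq, hcard, Fintype.card_fin, Finset.mem_Icc]
  omega

/-- The hypothesis `0 < n` is needed: the empty permutation is a derangement with no cycles, which
`derangementPoly 0 = 0` does not count. -/
theorem eval_derangementPoly {n : ℕ} (hn : 0 < n) (x : ℝ) :
    (derangementPoly n).eval x =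
      ∑ j ∈ Finset.range (n + 1),
        (n.choose j : ℝ) * ((-x) ^ j * (ascPochhammer ℝ (n - j)).eval x) := by
  rw [← sum_derangements_pow_cycleCount, ← Finset.sum_fiberwise_of_maps_to
    (g := cycleCount) (t := Finset.Icc 1 (n / 2))
    (fun σ hσ => cycleCount_mem_Icc hn (Finset.mem_filter.1 hσ).2)]
  simp only [derangementPoly, eval_finsetSum, eval_mul, eval_C, eval_pow, eval_X]
  refine Finset.sum_congr rfl fun k _ => ?_
  rw [Finset.sum_congr rfl fun σ hσ => by rw [(Finset.mem_filter.1 hσ).2], Finset.sum_const,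
    nsmul_eq_mul, Finset.filter_filter]
  rfl

end CycleCount

/-! ### Asymptotics away from the non-positive integers -/

section Asymptotics

open Filter Topology

/-- `(x)ₙ / n!`, the coefficient of `zⁿ` in `(1 - z)⁻ˣ`. -/
noncomputable def risingCoeff (x : ℝ) (n : ℕ) : ℝ :=
  (ascPochhammer ℝ n).eval x / n.factorial

theorem eval_derangementPoly_div_factorial {n : ℕ} (hn : 0 < n) (x : ℝ) :
    (derangementPoly n).eval x / n.factorial =
      ∑ j ∈ Finset.range (n + 1), (-x) ^ j / j.factorial * risingCoeff x (n - j) := by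
  rw [eval_derangementPoly hn, Finset.sum_div]
  refine Finset.sum_congr rfl fun j hj => ?_
  rw [Nat.cast_choose ℝ (Finset.mem_range_succ_iff.1 hj), risingCoeff]
  have h1 := Nat.cast_ne_zero (R := ℝ).2 n.factorial_ne_zero
  have h2 := Nat.cast_ne_zero (R := ℝ).2 j.factorial_ne_zero
  have h3 := Nat.cast_ne_zero (R := ℝ).2 (n - j).factorial_ne_zero
  field_simp

theorem risingCoeff_succ (x : ℝ) (n : ℕ) :
    risingCoeff x (n + 1) = risingCoeff x n * ((x + n) / (n + 1)) := by
  rw [risingCoeff, risingCoeff, ascPochhammer_succ_eval, Nat.factorial_succ]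
  push_cast
  rw [mul_comm ((n : ℝ) + 1), mul_div_mul_comm]

theorem eval_ascPochhammer_eq_prod (x : ℝ) (n : ℕ) :
    (ascPochhammer ℝ n).eval x = ∏ i ∈ Finset.range n, (x + i) := by
  induction n with
  | zero => simp
  | succ n ih => rw [ascPochhammer_succ_eval, ih, Finset.prod_range_succ]

variable {x : ℝ}

theorem risingCoeff_ne_zero (hx : ∀ m : ℕ, x + m ≠ 0) (n : ℕ) : risingCoeff x n ≠ 0 := by
  refine div_ne_zero ?_ (Nat.cast_ne_zero.2 n.factorial_ne_zero)
  rw [eval_ascPochhammer_eq_prod]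
  exact Finset.prod_ne_zero_iff.2 fun i _ => hx i

theorem tendsto_risingCoeff_ratio_succ (hx : ∀ m : ℕ, x + m ≠ 0) :
    Tendsto (fun m : ℕ => risingCoeff x m / risingCoeff x (m + 1)) atTop (𝓝 1) := by
  have h (m : ℕ) : risingCoeff x m / risingCoeff x (m + 1) = ((m : ℝ) + 1) / (m + x) := by
    rw [risingCoeff_succ, div_mul_cancel_left₀ (risingCoeff_ne_zero hx m), inv_div,
      add_comm x]
  simp only [h]
  have := tendsto_add_mul_div_add_mul_atTop_nhds (𝕜 := ℝ) 1 x 1 (d := 1) one_ne_zero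
  simpa [add_comm] using this

theorem tendsto_risingCoeff_ratio (hx : ∀ m : ℕ, x + m ≠ 0) (j : ℕ) :
    Tendsto (fun m : ℕ => risingCoeff x m / risingCoeff x (m + j)) atTop (𝓝 1) := by
  induction j with
  | zero => simp [div_self (risingCoeff_ne_zero hx _)]
  | succ j ih =>
    have h1 := ih.mul ((tendsto_risingCoeff_ratio_succ hx).comp (tendsto_add_atTop_nat j))
    rw [one_mul] at h1
    refine h1.congr fun m => ?_
    simp only [Function.comp_apply]
    rw [div_mul_div_cancel₀ (risingCoeff_ne_zero hx _), add_assoc]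

theorem exists_risingCoeff_ratio_bound (hx : ∀ m : ℕ, x + m ≠ 0) :
    ∃ K : ℝ, ∀ m j : ℕ, |risingCoeff x m / risingCoeff x (m + j)| ≤ K ^ j := by
  obtain ⟨K, hK⟩ := (tendsto_risingCoeff_ratio_succ hx).abs.bddAbove_range
  have hK' (m : ℕ) : |risingCoeff x m / risingCoeff x (m + 1)| ≤ K := hK ⟨m, rfl⟩
  refine ⟨K, fun m j => ?_⟩
  induction j with
  | zero => simp [div_self (risingCoeff_ne_zero hx _)]
  | succ j ih =>
    rw [← div_mul_div_cancel₀ (risingCoeff_ne_zero hx (m + j)), abs_mul, pow_succ]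
    exact mul_le_mul ih (hK' _) (abs_nonneg _) ((abs_nonneg _).trans ih)

/-- The convolution defining `D_n(x) / n!` is dominated termwise by an exponential series after
division by `(x)ₙ / n!`, so the limit may be taken term by term. -/
theorem tendsto_derangementPoly_ratio (hx : ∀ m : ℕ, x + m ≠ 0) :
    Tendsto (fun n : ℕ => (derangementPoly n).eval x / n.factorial / risingCoeff x n) atTop
      (𝓝 (Real.exp (-x))) := by
  obtain ⟨K, hK⟩ := exists_risingCoeff_ratio_bound hx
  have hK0 : 0 ≤ K := by simpa using (abs_nonneg _).trans (hK 0 1)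
  -- The finite convolution as a series over all `j`, extended by zero.
  let f : ℕ → ℕ → ℝ := fun n j =>
    if j ≤ n then (-x) ^ j / j.factorial * (risingCoeff x (n - j) / risingCoeff x n) else 0
  have hlim : Tendsto (fun n => ∑' j, f n j) atTop (𝓝 (∑' j : ℕ, (-x) ^ j / j.factorial)) := by
    refine tendsto_tsum_of_dominated_convergence
      (bound := fun j : ℕ => (|x| * K) ^ j / j.factorial) (Real.summable_pow_div_factorial _)
      (fun j => ?_) (Eventually.of_forall fun n j => ?_)
    · rw [← tendsto_add_atTop_iff_nat j]
      simpa [f] using (tendsto_risingCoeff_ratio hx j).const_mul ((-x) ^ j / j.factorial)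
    · by_cases h : j ≤ n
      · have h1 := hK (n - j) j
        rw [Nat.sub_add_cancel h] at h1
        simp only [f, if_pos h, norm_mul, norm_div, norm_pow, norm_neg, Real.norm_eq_abs,
          Nat.abs_cast, mul_pow]
        rw [← abs_div, mul_div_right_comm]
        gcongr
      · simp only [f, if_neg h, norm_zero]
        positivity
  rw [Real.exp_eq_exp_ℝ, NormedSpace.exp_eq_tsum_div]
  refine hlim.congr' ?_
  filter_upwards [eventually_gt_atTop 0] with n hn
  rw [eval_derangementPoly_div_factorial hn, Finset.sum_div,
    tsum_eq_sum (s := Finset.range (n + 1)) fun j hj =>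
      if_neg fun h => hj (Finset.mem_range_succ_iff.2 h)]
  refine Finset.sum_congr rfl fun j hj => ?_
  simp only [if_pos (Finset.mem_range_succ_iff.1 hj), mul_div_assoc]

theorem eventually_derangementPoly_mul_pos (hx : ∀ m : ℕ, x + m ≠ 0) :
    ∀ᶠ n : ℕ in atTop, 0 < (derangementPoly n).eval x * (ascPochhammer ℝ n).eval x := by
  filter_upwards [(tendsto_derangementPoly_ratio hx).eventually_const_lt (Real.exp_pos _)] with n hn
  have hf : (0 : ℝ) < n.factorial := Nat.cast_pos.2 n.factorial_pos
  rw [risingCoeff, div_div_div_cancel_right₀ hf.ne'] at hn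
  have hne : (ascPochhammer ℝ n).eval x ≠ 0 := fun h => by simp [h] at hn
  have := mul_pos hn (mul_self_pos.2 hne)
  rwa [← mul_assoc, div_mul_cancel₀ _ hne] at this

/-- Of the factors of `(-s - δ)ₙ (-s + δ)ₙ`, paired by index, only the one of index `s` is
negative. -/
theorem ascPochhammer_mul_neg {s n : ℕ} (hs : s < n) {δ : ℝ} (hδ : 0 < δ) (hδ1 : δ < 1) :
    (ascPochhammer ℝ n).eval (-s - δ) * (ascPochhammer ℝ n).eval (-s + δ) < 0 := by
  rw [eval_ascPochhammer_eq_prod, eval_ascPochhammer_eq_prod, ← Finset.prod_mul_distrib,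
    ← Finset.mul_prod_erase _ _ (Finset.mem_range.2 hs)]
  refine mul_neg_of_neg_of_pos (by nlinarith) (Finset.prod_pos fun i hi => ?_)
  have h1 : (1 : ℝ) ≤ |(i : ℝ) - s| := by
    have : (1 : ℤ) ≤ |(i : ℤ) - s| :=
      Int.one_le_abs (sub_ne_zero.2 (Nat.cast_injective.ne (Finset.ne_of_mem_erase hi)))
    exact_mod_cast this
  have h2 : (1 : ℝ) ≤ ((i : ℝ) - s) ^ 2 := by
    rw [← sq_abs]
    exact one_le_pow₀ h1
  nlinarith

/-! ### Roots near negative integers -/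

theorem eventually_exists_root_near_neg (s : ℕ) {ε : ℝ} (hε : 0 < ε) :
    ∀ᶠ n : ℕ in atTop, ∃ x : ℝ, (derangementPoly n).IsRoot x ∧ |-(s : ℝ) - x| < ε := by
  obtain ⟨δ, hδ, hδ'⟩ := exists_between (lt_min hε one_pos)
  obtain ⟨hδε, hδ1⟩ := lt_min_iff.1 hδ'
  have hne (m : ℕ) : (m : ℝ) - s ≠ δ ∧ (m : ℝ) - s ≠ -δ := by
    -- A number at distance `δ ∈ (0, 1)` from an integer is not an integer.
    have key (r : ℝ) (hr : |r| = δ) : (m : ℝ) - s ≠ r := fun h => by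
      have h1 : |((m - s : ℤ) : ℝ)| = δ := by push_cast; rw [h, hr]
      have h2 : |(m : ℤ) - s| < 1 := by
        have : |((m - s : ℤ) : ℝ)| < 1 := h1.trans_lt hδ1
        exact_mod_cast this
      rw [Int.abs_lt_one_iff.1 h2] at h1
      simp at h1
      exact hδ.ne h1
    exact ⟨key _ (abs_of_pos hδ), key _ (by rw [abs_neg, abs_of_pos hδ])⟩
  filter_upwards [eventually_gt_atTop s,
    eventually_derangementPoly_mul_pos (x := -s - δ) fun m h => (hne m).1 (by linarith),
    eventually_derangementPoly_mul_pos (x := -s + δ) fun m h => (hne m).2 (by linarith)]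
    with n hn h1 h2
  have h3 := ascPochhammer_mul_neg hn hδ hδ1
  have h4 : (derangementPoly n).eval (-s - δ) * (derangementPoly n).eval (-s + δ) < 0 := by
    -- Multiplying `h1` by `h2` shows that the two products have the same sign.
    by_contra! h
    have := mul_pos h1 h2
    nlinarith [mul_nonpos_of_nonneg_of_nonpos h h3.le]
  have h0 : (0 : ℝ) ∈ Set.uIcc ((derangementPoly n).eval (-s - δ))
      ((derangementPoly n).eval (-s + δ)) := by
    rw [Set.mem_uIcc]
    rcases mul_neg_iff.1 h4 with h | h
    · exact Or.inr ⟨h.2.le, h.1.le⟩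
    · exact Or.inl ⟨h.1.le, h.2.le⟩
  obtain ⟨x, hx, hx0⟩ := intermediate_value_uIcc (derangementPoly n).continuous.continuousOn h0
  rw [Set.uIcc_of_le (by linarith)] at hx
  exact ⟨x, hx0, abs_lt.2 ⟨by linarith [hx.2], by linarith [hx.1]⟩⟩

end Asymptotics

theorem derangementPoly_isRoot_zero (n : ℕ) : (derangementPoly n).IsRoot 0 := by
  simp only [derangementPoly, IsRoot.def, eval_finsetSum, eval_mul, eval_C, eval_pow, eval_X]
  refine Finset.sum_eq_zero fun k hk => ?_
  rw [zero_pow (Nat.one_le_iff_ne_zero.1 (Finset.mem_Icc.1 hk).1), mul_zero]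

theorem theorem2 (t : ℕ) (ht : 0 < t) (ε : ℝ) (hε : 0 < ε) :
    ∃ N : ℕ, 0 < N ∧ ∀ n : ℕ, N < n →
      (derangementPoly n).IsRoot 0 ∧
      ∀ s : ℕ, 1 ≤ s → s ≤ t →
        ∃ x : ℝ, (derangementPoly n).IsRoot x ∧ |-(s : ℝ) - x| < ε := by
  have h := (Filter.eventually_all_finset (Finset.Icc 1 t)).2 fun s _ =>
    eventually_exists_root_near_neg s hε
  obtain ⟨N, hN⟩ := Filter.eventually_atTop.1 h
  exact ⟨N + 1, N.succ_pos, fun n hn => ⟨derangementPoly_isRoot_zero n, fun s hs hst =>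
    hN n (by omega) s (Finset.mem_Icc.2 ⟨hs, hst⟩)⟩⟩
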